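/- Let $k$ be a field, $n\ge 1$, and let $A=\{\mathbf a_1,\dots,\mathbf a_p\}$ and $B=\{\mathbf b_1,\dots,\mathbf b_q\}$ be finite families of vectors in $\mathbb N^n$ (where $0\in\mathbb N$) that do not both contain the zero vector. For a finite family $V=\{\mathbf v_1,\dots,\mathbf v_m\}$ in $\mathbb N^n$ let $\phi_V:k[z_1,\dots,z_m]\to k[t_1,\dots,t_n]$ be the $k$-algebra homomorphism with $\phi_V(z_i)=t^{\mathbf v_i}$, let $I_V=\ker\phi_V$, and let $k[V]=\operatorname{im}\phi_V\cong k[z_1,\dots,z_m]/I_V$ be the semigroup ring of the semigroup $\langle V\rangle$ generated by $V$. Denote by $\operatorname{depth} k[V]$ the depth with respect to the irrelevant ideal (the elements of $k[V]$ with zero constant term), i.e. the supremum of the lengths of regular sequences in that ideal; $k[V]$ is Cohen–Macaulay if it is Noetherian and all its localizations at primes have depth equal to their Krull dimension. For positive integers $k_1,k_2$ and $C=k_1A\cup k_2B$, with variables $x_1,\dots,x_p$ corresponding to $k_1\mathbf a_1,\dots,k_1\mathbf a_p$ and $y_1,\dots,y_q$ corresponding to $k_2\mathbf b_1,\dots,k_2\mathbf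 b_q$, the semigroup $\langle C\rangle$ is called a gluing of $\langle A\rangle$ and $\langle B\rangle$ if in $k[x_1,\dots,x_p,y_1,\dots,y_q]$ $$I_C=I_A+I_B+\langle\rho\rangle$$ (with $I_A$, $I_B$ replaced by the ideals they generate) for some binomial $\rho=x^\alpha-y^\beta$ with $\alpha\in\mathbb N^p\setminus\{0\}$ and $\beta\in\mathbb N^q\setminus\{0\}$. Suppose that the elements of $B$ lie on a line, i.e. $q\ge 2$ and there are $\mathbf b\in\mathbb N^n$ and $u_1,\dots,u_q\in\mathbb N$ with $\mathbf b_j=u_j\mathbf b$ for all $j$, and that $\langle C\rangle$ is a gluing of $\langle A\rangle$ and $\langle B\rangle$. Then $$\dim k[C]=\dim k[A]\qquad\text{and}\qquad \operatorname{depth} k[C]=\operatorname{depth} k[A].$$ Moreover, $k[C]$ is Cohen–Macaulay if and only if $k[A]$ is Cohen–Macaulay. -/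

import Mathlib

noncomputable section

namespace SemigroupGluing

open MvPolynomial

variable (k : Type*) [Field k] {n : ℕ} {ι : Type*}

/-- For a family of vectors `v i ∈ ℕⁿ`, the homomorphism `φ : k[x_i : i ∈ ι] → k[t₁, …, tₙ]`
with `φ (x_i) = t ^ (v i)`. -/
def toricMap (v : ι → (Fin n →₀ ℕ)) : MvPolynomial ι k →ₐ[k] MvPolynomial (Fin n) k :=
  aeval fun i => monomial (v i) (1 : k)

/-- The defining ideal `I_A = ker φ`. -/
def toricIdeal (v : ι → (Fin n →₀ ℕ)) : Ideal (MvPolynomial ι k) :=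
  RingHom.ker (toricMap k v)

/-- The semigroup ring `k[A]`, as the subring of `k[t₁, …, tₙ]` generated over `k` by the
monomials `t ^ (v i)`, that is, the image of `φ`. -/
def semigroupRing (v : ι → (Fin n →₀ ℕ)) : Subalgebra k (MvPolynomial (Fin n) k) :=
  (toricMap k v).range

/-- The irrelevant maximal ideal of `k[A]`: its elements with zero constant term, that is, the
`k`-span of the monomials `t ^ s` with `s ≠ 0` in the semigroup. -/
def irrelevantIdeal (v : ι → (Fin n →₀ ℕ)) : Ideal (semigroupRing k v) :=
  RingHom.ker ((constantCoeff : MvPolynomial (Fin n) k →+* k).comp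
    (semigroupRing k v).val.toRingHom)

/-- The depth of a ring with respect to an ideal: the supremum of the lengths of the regular
sequences of the ring that are contained in the ideal. -/
def idealDepth {R : Type*} [CommRing R] (I : Ideal R) : ℕ∞ :=
  ⨆ rs : {rs : List R // RingTheory.Sequence.IsRegular R rs ∧ ∀ r ∈ rs, r ∈ I},
    (rs.1.length : ℕ∞)

/-- The depth of the graded ring `k[A]`: the depth with respect to its irrelevant ideal. -/
def depth (v : ι → (Fin n →₀ ℕ)) : ℕ∞ :=
  idealDepth (irrelevantIdeal k v)

/-- A commutative ring is Cohen-Macaulay if it is Noetherian and, for every prime `P`, the depth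
of the local ring `R_P` equals its Krull dimension. -/
def IsCohenMacaulay (R : Type*) [CommRing R] : Prop :=
  IsNoetherianRing R ∧ ∀ (P : Ideal R) [P.IsPrime],
    (idealDepth (IsLocalRing.maximalIdeal (Localization.AtPrime P)) : WithBot ℕ∞) =
      ringKrullDim (Localization.AtPrime P)

/-- The generating family of `C = k₁ A ∪ k₂ B`. The variables `x_i` are indexed by the left
summand and the variables `y_j` by the right one. -/
def glueFamily {p q : ℕ} (a : Fin p → (Fin n →₀ ℕ)) (b : Fin q → (Fin n →₀ ℕ)) (k₁ k₂ : ℕ) :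
    Fin p ⊕ Fin q → (Fin n →₀ ℕ) :=
  Sum.elim (fun i => k₁ • a i) (fun j => k₂ • b j)

/-- For `C = k₁ A ∪ k₂ B`, the semigroup `⟨C⟩` is a gluing of `⟨A⟩` and `⟨B⟩`:
`k₁, k₂ > 0` and `I_C = I_A + I_B + ⟨ρ⟩` in `k[x₁, …, x_p, y₁, …, y_q]` for a
binomial `ρ = x ^ α - y ^ β` whose two monomials are not constant. -/
def IsGluing {p q : ℕ} (a : Fin p → (Fin n →₀ ℕ)) (b : Fin q → (Fin n →₀ ℕ)) (k₁ k₂ : ℕ) :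
    Prop :=
  0 < k₁ ∧ 0 < k₂ ∧ ∃ (α : Fin p →₀ ℕ) (β : Fin q →₀ ℕ), α ≠ 0 ∧ β ≠ 0 ∧
    toricIdeal k (glueFamily a b k₁ k₂) =
      (toricIdeal k a).map (rename (Sum.inl : Fin p → Fin p ⊕ Fin q)) ⊔
      (toricIdeal k b).map (rename (Sum.inr : Fin q → Fin p ⊕ Fin q)) ⊔
      Ideal.span {rename Sum.inl (monomial α (1 : k)) - rename Sum.inr (monomial β (1 : k))}

/-- The elements of `B` lie on a line: `q ≥ 2` and `B = b [u₁ … u_q]` for some `b ∈ ℕⁿ` and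
some `u₁, …, u_q ∈ ℕ`. -/
def LieOnLine {q : ℕ} (b : Fin q → (Fin n →₀ ℕ)) : Prop :=
  2 ≤ q ∧ ∃ (d : Fin n →₀ ℕ) (u : Fin q → ℕ), ∀ j, b j = u j • d

end SemigroupGluing

end

/-! The map `t ^ s ↦ t ^ (k₁ s)` makes `k[C]` a finite free `k[A]`-module, and such an extension
preserves dimension, depth and the Cohen–Macaulay property.

For freeness, write `b j = u j • d`, let `S ⊆ ℕ` be generated by the `u j`, and let `m` be the
`u`-degree of `β`. Every element of `⟨C⟩` is `k₁ s + k₂ w d` with `s ∈ ⟨A⟩` and `w ∈ S`. Since `ρ ∈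
I_C`, the vector `k₂ m d` equals `k₁` times the degree of `x ^ α`, so multiples of `m` can be moved
from `w` into `s` until `w` lies in the Apéry set of `S` with respect to `m`. By
`linearCombination_eq_of_gluing` the class of `w` mod `m` depends only on the vector, and an Apéry
set has at most one element per class. Hence the monomials `t ^ (k₂ w d)`, `w` in the Apéry set,
form a finite basis (`nonempty_basis_of_existsUnique`).

For the transfer, heights agree by incomparability and going-down. Regular sequences pass up by
flatness; downwards, Ext vanishing and prime avoidance replace a sequence above by one from the
base, which then descends (`idealDepth_eq_of_faithfullyFlat`). Applied to irrelevant ideals this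
gives depth; applied at all localizations it gives Cohen–Macaulayness. -/

noncomputable section

namespace SemigroupGluing

open RingTheory.Sequence CategoryTheory Abelian Limits Pointwise

universe u v

/-! ### Depth under faithfully flat extensions -/

section Depth

/-- Weak regularity of a sequence descends along faithfully flat base change. -/
theorem isWeaklyRegular_of_faithfullyFlat_of_isBaseChange {R S M N : Type*} [CommRing R]
    [CommRing S] [Algebra R S] [AddCommGroup M] [Module R M] [AddCommGroup N] [Module R N]
    [Module S N] [IsScalarTower R S N] [Module.FaithfullyFlat R S] {f : M →ₗ[R] N}
    (hf : IsBaseChange S f) {rs : List R}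
    (reg : IsWeaklyRegular N (rs.map (algebraMap R S))) : IsWeaklyRegular M rs := by
  induction rs generalizing M N with
  | nil => simp
  | cons x _ ih =>
    simp only [List.map_cons, isWeaklyRegular_cons_iff] at reg ⊢
    have e := (QuotSMulTop.algebraMapTensorEquivTensorQuotSMulTop x M S).symm ≪≫ₗ
      QuotSMulTop.congr ((algebraMap R S) x) hf.equiv
    have hg : IsBaseChange S <|
        e.toLinearMap.restrictScalars R ∘ₗ TensorProduct.mk R S (QuotSMulTop x M) 1 :=
      IsBaseChange.of_equiv e (fun _ ↦ by simp)
    refine ⟨?_, ih hg reg.2⟩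
    have hinj : Function.Injective f := by
      have h : (f : M → N) = hf.equiv ∘ TensorProduct.mk R S M 1 := by
        ext y
        simp [hf.equiv_tmul]
      rw [h]
      exact hf.equiv.injective.comp
        (Module.FaithfullyFlat.tensorProduct_mk_injective (A := R) (B := S) M)
    intro y z hyz
    refine hinj (reg.1 ?_)
    have := congrArg f hyz
    simpa using this

theorem isRegular_of_faithfullyFlat {R S : Type*} [CommRing R] [CommRing S] [Algebra R S]
    [Module.FaithfullyFlat R S] {rs : List R}
    (reg : IsRegular S (rs.map (algebraMap R S))) : IsRegular R rs := by
  have hf := IsBaseChange.linearMap R S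
  refine ⟨isWeaklyRegular_of_faithfullyFlat_of_isBaseChange hf reg.1, ?_⟩
  have h := reg.2
  rw [← Ideal.map_ofList] at h
  exact ((hf.map_smul_top_ne_top_iff_of_faithfullyFlat R R _).mp h.symm).symm

theorem smul_top_quotSMulTop_lt_top {R M : Type*} [CommRing R] [AddCommGroup M] [Module R M]
    {I : Ideal R} {r : R} (hr : r ∈ I) (hI : I • (⊤ : Submodule R M) < ⊤) :
    I • (⊤ : Submodule R (QuotSMulTop r M)) < ⊤ := by
  refine lt_top_iff_ne_top.mpr fun eq ↦ ?_
  absurd congrArg (Submodule.comap (Submodule.mkQ _)) eq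
  simpa [Submodule.comap_smul_top_of_surjective I _ (Submodule.mkQ_surjective _),
    Submodule.smul_mono_left ((Ideal.span_singleton_le_iff_mem I).mpr hr),
    ← Submodule.ideal_span_singleton_smul] using hI.ne

/-- If an extended ideal contains a nonzerodivisor on a finite module, then so does the ideal
it is extended from. -/
theorem exists_isSMulRegular_of_mem_map {R S M : Type*} [CommRing R] [CommRing S] [Algebra R S]
    [IsNoetherianRing S] [AddCommGroup M] [Module S M] [Module.Finite S M] (I : Ideal R) {x : S}
    (hx : x ∈ I.map (algebraMap R S)) (hreg : IsSMulRegular M x) :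
    ∃ y ∈ I, IsSMulRegular M (algebraMap R S y) := by
  by_contra! h
  -- Prime avoidance is applied in `R`, to the contractions of the finitely many associated primes
  -- of `M`. The two exceptional indices are set to `⊥` because every contraction is prime.
  have hsub : (I : Set R) ⊆ ⋃ P ∈ associatedPrimes S M, (P.comap (algebraMap R S) : Ideal R) := by
    intro y hy
    have hmem : algebraMap R S y ∈ ⋃ P ∈ associatedPrimes S M, (P : Set S) := by
      rw [biUnion_associatedPrimes_eq_zero_divisors]
      by_contra hn
      refine h y hy ?_
      rw [isSMulRegular_iff_right_eq_zero_of_smul]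
      intro z hz
      by_contra hz0
      exact hn ⟨z, hz0, hz⟩
    simpa using hmem
  obtain ⟨P, hP, hle⟩ := (Ideal.subset_union_prime_finite (associatedPrimes.finite S M)
    (f := fun P : Ideal S ↦ P.comap (algebraMap R S)) ⊥ ⊥
    fun P hP _ _ ↦ by
      have := hP.isPrime
      exact Ideal.comap_isPrime _ _).mp hsub
  have hxP : x ∈ ⋃ P ∈ associatedPrimes S M, (P : Set S) :=
    Set.mem_biUnion hP (Ideal.map_le_iff_le_comap.mpr hle hx)
  rw [biUnion_associatedPrimes_eq_zero_divisors] at hxP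
  obtain ⟨z, hz0, hz⟩ := hxP
  exact hz0 ((isSMulRegular_iff_right_eq_zero_of_smul.mp hreg) z hz)

/-- Rees's argument with elements chosen in the base: vanishing Hom gives a nonzerodivisor in the
extended ideal, prime avoidance moves it into `I`, and the long exact Ext sequence shortens the
vanishing range by one on the quotient. -/
theorem exists_isRegular_map_of_subsingleton_ext {R : Type v} {S : Type u} [CommRing R]
    [CommRing S] [Algebra R S] [IsNoetherianRing S] (I : Ideal R) (n : ℕ) (M : ModuleCat.{u} S)
    [Module.Finite S M] (hlt : I.map (algebraMap R S) • (⊤ : Submodule S M) < ⊤)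
    (hext : ∀ i < n, Subsingleton
      (Ext (ModuleCat.of S (S ⧸ I.map (algebraMap R S))) M i)) :
    ∃ rs : List R, rs.length = n ∧ (∀ r ∈ rs, r ∈ I) ∧
      IsRegular M (rs.map (algebraMap R S)) := by
  induction n generalizing M with
  | zero =>
    have : Nontrivial M := (Submodule.nontrivial_iff S).mp (nontrivial_of_lt _ _ hlt)
    exact ⟨[], by simp, by simp, by simpa using IsRegular.nil S M⟩
  | succ n ih =>
    set N := ModuleCat.of S (S ⧸ I.map (algebraMap R S))
    have : Module.Finite S N := inferInstanceAs (Module.Finite S (S ⧸ I.map (algebraMap R S)))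
    have : Subsingleton (N ⟶ M) := Ext.addEquiv₀.subsingleton_congr.mp (hext 0 n.zero_lt_succ)
    have : Subsingleton (N →ₗ[S] M) := ModuleCat.homAddEquiv.symm.subsingleton
    obtain ⟨x, mem_ann, hx⟩ := IsSMulRegular.subsingleton_linearMap_iff.mp this
    have hxI : x ∈ I.map (algebraMap R S) := by
      have : Module.annihilator S N = I.map (algebraMap R S) := Ideal.annihilator_quotient
      rwa [this] at mem_ann
    obtain ⟨y, hyI, hy⟩ := exists_isSMulRegular_of_mem_map I hxI hx
    have hext' : ∀ i < n, Subsingleton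
        (Ext N (ModuleCat.of S (QuotSMulTop (algebraMap R S y) M)) i) := by
      intro i hi
      have zero1 := AddCommGrpCat.isZero_of_iff_subsingleton.mpr (hext i (by omega))
      have zero2 := AddCommGrpCat.isZero_of_iff_subsingleton.mpr (hext (i + 1) (by omega))
      exact AddCommGrpCat.subsingleton_of_isZero <| ShortComplex.Exact.isZero_of_both_zeros
        ((Ext.covariant_sequence_exact₃' N hy.smulShortComplex_shortExact) i (i + 1) rfl)
        (zero1.eq_zero_of_src _) (zero2.eq_zero_of_tgt _)
    obtain ⟨rs, len, mem, reg⟩ := ih (ModuleCat.of S (QuotSMulTop (algebraMap R S y) M))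
      (smul_top_quotSMulTop_lt_top (Ideal.mem_map_of_mem _ hyI) hlt) hext'
    refine ⟨y :: rs, by simp [len], by simpa [hyI] using mem, ?_⟩
    exact IsRegular.cons hy reg

/-- A regular sequence in an ideal contained in the radical of an extended ideal can be replaced
by one of the same length coming from the base ring. -/
theorem exists_isRegular_map_of_le_radical {R : Type v} {S : Type u} [CommRing R]
    [CommRing S] [Algebra R S] [IsNoetherianRing S] {I : Ideal R} {J : Ideal S}
    (hIJ : I.map (algebraMap R S) ≤ J) (hJI : J ≤ (I.map (algebraMap R S)).radical)
    (hJ : J ≠ ⊤) {rs : List S} (hrs : IsRegular S rs) (hmem : ∀ r ∈ rs, r ∈ J) :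
    ∃ rs' : List R, rs'.length = rs.length ∧ (∀ r ∈ rs', r ∈ I) ∧
      IsRegular S (rs'.map (algebraMap R S)) := by
  -- The radical hypothesis puts the support of `S / IS` inside `V(J)`, so a regular sequence in `J`
  -- forces the Ext groups from `S / IS` to vanish.
  have hsupp : Module.support S (S ⧸ I.map (algebraMap R S)) ⊆ PrimeSpectrum.zeroLocus J := by
    rw [Module.support_eq_zeroLocus, Ideal.annihilator_quotient,
      PrimeSpectrum.zeroLocus_subset_zeroLocus_iff]
    exact hJI
  refine exists_isRegular_map_of_subsingleton_ext I rs.length (ModuleCat.of S S) ?_ ?_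
  · simpa using lt_of_le_of_lt hIJ hJ.lt_top
  · exact ModuleCat.subsingleton_ext_of_exists_isRegular J
      (ModuleCat.of S (S ⧸ I.map (algebraMap R S))) hsupp (ModuleCat.of S S)
      (by simpa using hJ.lt_top) rs hmem hrs

theorem idealDepth_eq_of_faithfullyFlat {R S : Type*} [CommRing R]
    [CommRing S] [Algebra R S] [IsNoetherianRing S] [Module.FaithfullyFlat R S]
    {I : Ideal R} {J : Ideal S} (hIJ : I.map (algebraMap R S) ≤ J)
    (hJI : J ≤ (I.map (algebraMap R S)).radical) (hJ : J ≠ ⊤) :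
    idealDepth J = idealDepth I := by
  apply le_antisymm
  · refine iSup_le fun ⟨rs, hrs, hmem⟩ ↦ ?_
    obtain ⟨rs', hlen, hmem', hreg⟩ := exists_isRegular_map_of_le_radical hIJ hJI hJ hrs hmem
    exact le_iSup_of_le ⟨rs', isRegular_of_faithfullyFlat hreg, hmem'⟩ (by simp [hlen])
  · refine iSup_le fun ⟨rs, hrs, hmem⟩ ↦ ?_
    refine le_iSup_of_le ⟨rs.map (algebraMap R S), hrs.of_faithfullyFlat, ?_⟩ (by simp)
    intro r hr
    obtain ⟨r', hr', rfl⟩ := List.mem_map.mp hr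
    exact hIJ (Ideal.mem_map_of_mem _ (hmem r' hr'))

end Depth

/-! ### Integral faithfully flat extensions -/

section FiniteFlat

variable {R S : Type*} [CommRing R] [CommRing S] [Algebra R S]

/-- Incomparability makes contraction strictly monotone on primes, giving `≤`; going-down for flat
extensions gives `≥`. -/
theorem height_eq_of_liesOver_of_isIntegral_of_flat [IsNoetherianRing R] [IsNoetherianRing S] [Algebra.IsIntegral R S]
    [Module.Flat R S] (p : Ideal R) [p.IsPrime] (P : Ideal S) [P.IsPrime] [P.LiesOver p] :
    P.height = p.height := by
  apply le_antisymm
  · have hmono : StrictMono (PrimeSpectrum.comap (algebraMap R S)) := fun P Q h ↦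
      Ideal.IsIntegral.comap_lt_comap (R := R) (A := S) h
    have h := Order.height_le_height_apply_of_strictMono _ hmono ⟨P, inferInstance⟩
    have hp : PrimeSpectrum.comap (algebraMap R S) ⟨P, inferInstance⟩ = ⟨p, inferInstance⟩ :=
      PrimeSpectrum.ext (Ideal.LiesOver.over (p := p) (P := P)).symm
    rw [hp] at h
    rwa [← PrimeSpectrum.height_eq_orderHeight, ← PrimeSpectrum.height_eq_orderHeight] at h
  · rw [Ideal.height_eq_height_add_of_liesOver_of_hasGoingDown p P]
    exact le_self_add

theorem exists_liesOver_of_faithfullyFlat [Module.FaithfullyFlat R S] (p : Ideal R) [p.IsPrime] :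
    ∃ P : Ideal S, P.IsPrime ∧ P.LiesOver p := by
  obtain ⟨P, hP⟩ := PrimeSpectrum.comap_surjective_of_faithfullyFlat (A := R) (B := S)
    ⟨p, inferInstance⟩
  exact ⟨P.asIdeal, P.isPrime, ⟨(congrArg PrimeSpectrum.asIdeal hP).symm⟩⟩

theorem ringKrullDim_eq_of_isIntegral_of_faithfullyFlat [IsNoetherianRing R]
    [IsNoetherianRing S] [Algebra.IsIntegral R S] [Module.FaithfullyFlat R S] :
    ringKrullDim S = ringKrullDim R := by
  apply le_antisymm
  · refine (ringKrullDim_le_iff_height_le _).mpr fun P _ ↦ ?_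
    rw [height_eq_of_liesOver_of_isIntegral_of_flat (P.under R) P]
    exact (ringKrullDim_le_iff_height_le _).mp le_rfl inferInstance
  · refine (ringKrullDim_le_iff_height_le _).mpr fun p _ ↦ ?_
    obtain ⟨P, hP, _⟩ := exists_liesOver_of_faithfullyFlat (S := S) p
    rw [← height_eq_of_liesOver_of_isIntegral_of_flat p P]
    exact (ringKrullDim_le_iff_height_le _).mp le_rfl hP

/-- `S_P` need not be integral over `R_p`, so the argument returns to `S`: a prime containing the
extension of the maximal ideal contracts to a prime inside `P` whose contraction to `R` contains
`p`, and incomparability makes it `P`. -/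
theorem maximalIdeal_le_radical_map [Algebra.IsIntegral R S] (p : Ideal R) [p.IsPrime]
    (P : Ideal S) [P.IsPrime] [P.LiesOver p] [Algebra (Localization.AtPrime p) (Localization.AtPrime P)]
    [Localization.AtPrime.IsLiesOverAlgebra p P] :
    IsLocalRing.maximalIdeal (Localization.AtPrime P) ≤
      ((IsLocalRing.maximalIdeal (Localization.AtPrime p)).map
        (algebraMap (Localization.AtPrime p) (Localization.AtPrime P))).radical := by
  rw [Ideal.radical_eq_sInf]
  refine le_sInf fun Q ⟨hpQ, hQ⟩ ↦ ?_
  have hle : Q.under S ≤ P := by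
    refine le_trans ?_ (IsLocalization.AtPrime.under_maximalIdeal (Localization.AtPrime P) P).le
    exact Ideal.comap_mono (IsLocalRing.le_maximalIdeal hQ.ne_top)
  have hover : p ≤ (Q.under S).under R := by
    intro x hx
    have hx' : algebraMap R (Localization.AtPrime p) x ∈
        IsLocalRing.maximalIdeal (Localization.AtPrime p) :=
      (IsLocalization.AtPrime.to_map_mem_maximal_iff _ p x).mpr hx
    have := hpQ (Ideal.mem_map_of_mem (algebraMap _ (Localization.AtPrime P)) hx')
    rwa [← IsScalarTower.algebraMap_apply, IsScalarTower.algebraMap_apply R S] at this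
  have heq : Q.under S = P := by
    refine hle.eq_of_not_lt fun hlt ↦ ?_
    refine (Ideal.IsIntegral.comap_lt_comap (R := R) hlt).not_ge ?_
    exact (Ideal.LiesOver.over (p := p) (P := P)).ge.trans hover
  rw [← Localization.AtPrime.map_eq_maximalIdeal]
  exact Ideal.map_le_iff_le_comap.mpr heq.ge

theorem idealDepth_maximalIdeal_eq [IsNoetherianRing S] [Algebra.IsIntegral R S]
    [Module.Flat R S] (p : Ideal R) [p.IsPrime] (P : Ideal S) [P.IsPrime] [P.LiesOver p] :
    idealDepth (IsLocalRing.maximalIdeal (Localization.AtPrime P)) =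
      idealDepth (IsLocalRing.maximalIdeal (Localization.AtPrime p)) := by
  let := Localization.AtPrime.algebraOfLiesOver p P
  have : IsLocalHom (algebraMap (Localization.AtPrime p) (Localization.AtPrime P)) := by
    rw [RingHom.algebraMap_toAlgebra]
    exact Localization.isLocalHom_localRingHom p P (algebraMap R S) Ideal.LiesOver.over
  have : Module.FaithfullyFlat (Localization.AtPrime p) (Localization.AtPrime P) :=
    Module.FaithfullyFlat.of_flat_of_isLocalHom
  have : IsNoetherianRing (Localization.AtPrime P) :=
    IsLocalization.isNoetherianRing P.primeCompl _ inferInstance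
  exact idealDepth_eq_of_faithfullyFlat
    (((IsLocalRing.local_hom_TFAE (algebraMap (Localization.AtPrime p)
      (Localization.AtPrime P))).out 0 2).mp ‹_›)
    (maximalIdeal_le_radical_map p P) Ideal.IsPrime.ne_top'

theorem isCohenMacaulay_iff_of_isIntegral_of_faithfullyFlat [IsNoetherianRing R]
    [IsNoetherianRing S] [Algebra.IsIntegral R S] [Module.FaithfullyFlat R S] :
    IsCohenMacaulay S ↔ IsCohenMacaulay R := by
  refine ⟨fun h ↦ ⟨inferInstance, fun p _ ↦ ?_⟩, fun h ↦ ⟨inferInstance, fun P _ ↦ ?_⟩⟩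
  · obtain ⟨P, _, _⟩ := exists_liesOver_of_faithfullyFlat (S := S) p
    have := h.2 P
    rwa [IsLocalization.AtPrime.ringKrullDim_eq_height P, idealDepth_maximalIdeal_eq p P,
      height_eq_of_liesOver_of_isIntegral_of_flat p P,
      ← IsLocalization.AtPrime.ringKrullDim_eq_height p (Localization.AtPrime p)] at this
  · have := h.2 (P.under R)
    rwa [IsLocalization.AtPrime.ringKrullDim_eq_height P, idealDepth_maximalIdeal_eq (P.under R) P,
      height_eq_of_liesOver_of_isIntegral_of_flat (P.under R) P,
      ← IsLocalization.AtPrime.ringKrullDim_eq_height (P.under R)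
        (Localization.AtPrime (P.under R))]

end FiniteFlat

open MvPolynomial

/-! ### Semigroup rings: monomials, bases and irrelevant ideals -/

section SemigroupRing

variable {k : Type*} [Field k] {n : ℕ} {ι κ : Type*}

/-- The affine semigroup generated by a family of vectors. -/
def affineSemigroup (v : ι → (Fin n →₀ ℕ)) : Submodule ℕ (Fin n →₀ ℕ) :=
  LinearMap.range (Finsupp.linearCombination ℕ v)

theorem toricMap_monomial (v : ι → (Fin n →₀ ℕ)) (e : ι →₀ ℕ) (r : k) :
    toricMap k v (monomial e r) = monomial (Finsupp.linearCombination ℕ v e) r := by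
  rw [toricMap, aeval_monomial, Finsupp.linearCombination_apply, algebraMap_eq, Finsupp.prod]
  simp only [monomial_pow, one_pow]
  rw [Finsupp.sum, ← monomial_sum_one, C_mul_monomial, mul_one]

theorem monomial_mem_semigroupRing {v : ι → (Fin n →₀ ℕ)} {s : Fin n →₀ ℕ}
    (hs : s ∈ affineSemigroup v) (r : k) : monomial s r ∈ semigroupRing k v := by
  obtain ⟨e, rfl⟩ := hs
  exact ⟨monomial e r, toricMap_monomial v e r⟩

theorem semigroupRing_induction {v : ι → (Fin n →₀ ℕ)} {P : semigroupRing k v → Prop}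
    (add : ∀ f g, P f → P g → P (f + g))
    (mono : ∀ s (hs : s ∈ affineSemigroup v) (r : k),
      P ⟨monomial s r, monomial_mem_semigroupRing hs r⟩) (f : semigroupRing k v) : P f := by
  obtain ⟨f, g, rfl⟩ := f
  induction g using MvPolynomial.induction_on' with
  | monomial e r =>
    convert mono _ ⟨e, rfl⟩ r using 1
    exact Subtype.ext (toricMap_monomial v e r)
  | add p q hp hq =>
    convert add _ _ hp hq using 1
    exact Subtype.ext (map_add _ _ _)

theorem mem_affineSemigroup_of_coeff_ne_zero {v : ι → (Fin n →₀ ℕ)} (f : semigroupRing k v)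
    {s : Fin n →₀ ℕ} (hs : coeff s (f : MvPolynomial (Fin n) k) ≠ 0) : s ∈ affineSemigroup v := by
  induction f using semigroupRing_induction with
  | add f g hf hg =>
    by_contra h
    refine hs ?_
    rw [Subalgebra.coe_add, coeff_add, not_not.mp (mt hf h), not_not.mp (mt hg h), add_zero]
  | mono t ht r =>
    classical
    rw [coeff_monomial] at hs
    rwa [← (ite_ne_right_iff.mp hs).1]

instance [Finite ι] (v : ι → (Fin n →₀ ℕ)) : IsNoetherianRing (semigroupRing k v) :=
  inferInstanceAs (IsNoetherianRing (toricMap k v).range)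

variable {a : ι → (Fin n →₀ ℕ)} {c : κ → (Fin n →₀ ℕ)}
  [Algebra (semigroupRing k a) (semigroupRing k c)] {l : ℕ}

theorem exists_apply_of_coeff_expand_mul_monomial_ne_zero (f : semigroupRing k a)
    {t e : Fin n →₀ ℕ}
    (h : coeff t (expand l (f : MvPolynomial (Fin n) k) * monomial e 1) ≠ 0) :
    ∃ s ∈ affineSemigroup a, t = l • s + e := by
  classical
  rw [coeff_mul_monomial', mul_one] at h
  obtain ⟨hle, h⟩ := ite_ne_right_iff.mp h
  obtain ⟨s, hs, hst⟩ :=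
    Finset.mem_image.mp (support_expand_subset _ (mem_support_iff.mpr h))
  refine ⟨s, mem_affineSemigroup_of_coeff_ne_zero f (mem_support_iff.mp hs), ?_⟩
  rw [hst, tsub_add_cancel_of_le hle]

/-- If every element of `⟨C⟩` is uniquely of the form `l • s + e w` with `s ∈ ⟨A⟩`, then `k[C]` is
free over `k[A]` with basis the monomials `t ^ e w`. -/
theorem nonempty_basis_of_existsUnique (hl : 0 < l)
    (halg : ∀ f : semigroupRing k a,
      (algebraMap (semigroupRing k a) (semigroupRing k c) f : MvPolynomial (Fin n) k) =
        expand l (f : MvPolynomial (Fin n) k))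
    {W : Type*} (e : W → (Fin n →₀ ℕ)) (he : ∀ w, e w ∈ affineSemigroup c)
    (hex : ∀ t ∈ affineSemigroup c, ∃ s ∈ affineSemigroup a, ∃ w, t = l • s + e w)
    (huniq : ∀ s ∈ affineSemigroup a, ∀ s' ∈ affineSemigroup a, ∀ w w',
      l • s + e w = l • s' + e w' → w = w') :
    Nonempty (Module.Basis W (semigroupRing k a) (semigroupRing k c)) := by
  classical
  let b : W → semigroupRing k c := fun w ↦
    ⟨monomial (e w) 1, monomial_mem_semigroupRing (he w) 1⟩
  have hsmul (f : semigroupRing k a) (w : W) : ((f • b w : semigroupRing k c) :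
      MvPolynomial (Fin n) k) = expand l (f : MvPolynomial (Fin n) k) * monomial (e w) 1 := by
    rw [Algebra.smul_def, Subalgebra.coe_mul, halg]
  refine ⟨Module.Basis.mk (v := b) ?_ ?_⟩
  · rw [linearIndependent_iff']
    intro F g hg w hw
    by_contra hgw
    obtain ⟨s, hs⟩ := ne_zero_iff.mp (fun h ↦ hgw (Subtype.ext h) :
      (g w : MvPolynomial (Fin n) k) ≠ 0)
    have hsum := congrArg (fun f : semigroupRing k c ↦
      coeff (l • s + e w) (f : MvPolynomial (Fin n) k)) hg
    simp only [AddSubmonoidClass.coe_finsetSum, coeff_sum, hsmul] at hsum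
    -- By uniqueness, no other basis monomial contributes to the coefficient at `l • s + e w`.
    rw [Finset.sum_eq_single_of_mem w hw] at hsum
    · rw [coeff_mul_monomial, coeff_expand_smul l hl.ne', mul_one] at hsum
      exact hs (by simpa using hsum)
    · intro w' _ hw'
      by_contra h
      obtain ⟨s', hs', heq⟩ := exists_apply_of_coeff_expand_mul_monomial_ne_zero _ h
      exact hw' (huniq _ (mem_affineSemigroup_of_coeff_ne_zero _ hs) _ hs' _ _ heq).symm
  · rintro f -
    induction f using semigroupRing_induction with
    | add f g hf hg => exact add_mem hf hg
    | mono t ht r =>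
      obtain ⟨s, hs, w, rfl⟩ := hex t ht
      have : (⟨monomial (l • s + e w) r, monomial_mem_semigroupRing ht r⟩ : semigroupRing k c) =
          (⟨monomial s r, monomial_mem_semigroupRing hs r⟩ : semigroupRing k a) • b w := by
        refine Subtype.ext ?_
        rw [hsmul, expand_monomial, monomial_mul, mul_one]
      rw [this]
      exact Submodule.smul_mem _ _ (Submodule.subset_span ⟨w, rfl⟩)

theorem mem_irrelevantIdeal {v : ι → (Fin n →₀ ℕ)} {f : semigroupRing k v} :
    f ∈ irrelevantIdeal k v ↔ constantCoeff (f : MvPolynomial (Fin n) k) = 0 :=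
  Iff.rfl

theorem map_irrelevantIdeal_le (hl : 0 < l)
    (halg : ∀ f : semigroupRing k a,
      (algebraMap (semigroupRing k a) (semigroupRing k c) f : MvPolynomial (Fin n) k) =
        expand l (f : MvPolynomial (Fin n) k)) :
    (irrelevantIdeal k a).map (algebraMap (semigroupRing k a) (semigroupRing k c)) ≤
      irrelevantIdeal k c := by
  refine Ideal.map_le_iff_le_comap.mpr fun f hf ↦ ?_
  rw [Ideal.mem_comap, mem_irrelevantIdeal, halg, constantCoeff_eq, coeff_expand_zero l hl.ne']
  exact hf

/-- The radical is an ideal, so nonconstant monomials suffice, and the `m`-th power of each comes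
from a nonconstant monomial of `k[A]`. -/
theorem irrelevantIdeal_le_radical_map
    (halg : ∀ f : semigroupRing k a,
      (algebraMap (semigroupRing k a) (semigroupRing k c) f : MvPolynomial (Fin n) k) =
        expand l (f : MvPolynomial (Fin n) k))
    {m : ℕ} (hm : 0 < m) (hmul : ∀ t ∈ affineSemigroup c, ∃ s ∈ affineSemigroup a, m • t = l • s) :
    irrelevantIdeal k c ≤ ((irrelevantIdeal k a).map
      (algebraMap (semigroupRing k a) (semigroupRing k c))).radical := by
  set I := ((irrelevantIdeal k a).map
      (algebraMap (semigroupRing k a) (semigroupRing k c))).radical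
  -- Subtracting the constant term gives a statement about all `f`, which is additive and so open to
  -- induction.
  suffices h : ∀ f : semigroupRing k c,
      f - algebraMap k _ (constantCoeff (f : MvPolynomial (Fin n) k)) ∈ I by
    intro f hf
    simpa [mem_irrelevantIdeal.mp hf] using h f
  intro f
  induction f using semigroupRing_induction with
  | add f g hf hg =>
    convert add_mem hf hg using 1
    simp only [Subalgebra.coe_add, map_add]
    ring
  | mono t ht r =>
    classical
    rcases eq_or_ne t 0 with rfl | ht0
    · convert I.zero_mem
      refine Subtype.ext ?_
      simp [algebraMap_eq]
    · have h0 : constantCoeff (monomial t r) = 0 := by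
        rw [constantCoeff_monomial, if_neg ht0]
      simp only [h0, map_zero, sub_zero]
      obtain ⟨s, hs, hst⟩ := hmul t ht
      have hs0 : s ≠ 0 := by
        rintro rfl
        rw [smul_zero, smul_eq_zero] at hst
        exact hst.elim hm.ne' ht0
      refine ⟨m, ?_⟩
      have heq : (⟨monomial t r, monomial_mem_semigroupRing ht r⟩ : semigroupRing k c) ^ m =
          algebraMap (semigroupRing k a) (semigroupRing k c)
            ⟨monomial s (r ^ m), monomial_mem_semigroupRing hs _⟩ := by
        refine Subtype.ext ?_
        rw [halg, expand_monomial, SubmonoidClass.coe_pow, monomial_pow, hst]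
      rw [heq]
      refine Ideal.mem_map_of_mem _ ?_
      rw [mem_irrelevantIdeal, constantCoeff_monomial, if_neg hs0]

end SemigroupRing

/-! ### Apéry sets -/

section Apery

/-- The Apéry set of a numerical semigroup `S` with respect to `m`. -/
def aperySet (S : Submodule ℕ ℕ) (m : ℕ) : Set ℕ :=
  {w | w ∈ S ∧ ∀ w' ∈ S, w ≠ w' + m}

theorem exists_mem_aperySet {S : Submodule ℕ ℕ} {m : ℕ} (hm : 0 < m) {v : ℕ} (hv : v ∈ S) :
    ∃ w ∈ aperySet S m, ∃ j, v = w + j * m := by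
  induction v using Nat.strong_induction_on with
  | _ v ih =>
    by_cases h : ∃ v' ∈ S, v = v' + m
    · obtain ⟨v', hv', rfl⟩ := h
      obtain ⟨w, hw, j, rfl⟩ := ih v' (by omega) hv'
      exact ⟨w, hw, j + 1, by ring⟩
    · push Not at h
      exact ⟨v, ⟨hv, h⟩, 0, by simp⟩

/-- If two congruent elements differed, the larger would be `m` plus an element of `S`. No
coprimality is needed, as some classes may be missed. -/
theorem aperySet_injOn {S : Submodule ℕ ℕ} {m : ℕ} (hmS : m ∈ S) :
    Set.InjOn (fun w : ℕ ↦ (w : ZMod m)) (aperySet S m) := by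
  intro w hw w' hw' h
  wlog hle : w ≤ w' generalizing w w'
  · exact (this hw' hw h.symm (by omega)).symm
  obtain ⟨j, hj⟩ := (Nat.modEq_iff_dvd' hle).mp ((ZMod.natCast_eq_natCast_iff _ _ _).mp h)
  rcases j with _ | j
  · simp at hj
    omega
  · refine absurd ?_ (hw'.2 (w + j • m) (add_mem hw.1 (S.smul_mem j hmS)))
    simp only [smul_eq_mul]
    have : m * (j + 1) = j * m + m := by ring
    omega

theorem finite_aperySet {S : Submodule ℕ ℕ} {m : ℕ} (hm : 0 < m) (hmS : m ∈ S) :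
    (aperySet S m).Finite := by
  have : NeZero m := ⟨hm.ne'⟩
  exact Set.Finite.of_finite_image (Set.toFinite _) (aperySet_injOn hmS)

end Apery

/-! ### The gluing relation -/

section Gluing

variable {k : Type*} [Field k] {n p q : ℕ}

theorem toricMap_rename_inl (a : Fin p → (Fin n →₀ ℕ)) (b : Fin q → (Fin n →₀ ℕ)) (k₁ k₂ : ℕ)
    (f : MvPolynomial (Fin p) k) :
    toricMap k (glueFamily a b k₁ k₂) (rename Sum.inl f) = expand k₁ (toricMap k a f) := by
  refine DFunLike.congr_fun (f := (toricMap k (glueFamily a b k₁ k₂)).comp (rename Sum.inl))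
    (g := (expand k₁).comp (toricMap k a)) ?_ f
  ext1 i
  simp only [toricMap, glueFamily, AlgHom.comp_apply, rename_X, aeval_X, expand_monomial,
    Sum.elim_inl]

theorem toricMap_rename_inr (a : Fin p → (Fin n →₀ ℕ)) (b : Fin q → (Fin n →₀ ℕ)) (k₁ k₂ : ℕ)
    (f : MvPolynomial (Fin q) k) :
    toricMap k (glueFamily a b k₁ k₂) (rename Sum.inr f) = expand k₂ (toricMap k b f) := by
  refine DFunLike.congr_fun (f := (toricMap k (glueFamily a b k₁ k₂)).comp (rename Sum.inr))
    (g := (expand k₂).comp (toricMap k b)) ?_ f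
  ext1 i
  simp only [toricMap, glueFamily, AlgHom.comp_apply, rename_X, aeval_X, expand_monomial,
    Sum.elim_inr]

theorem mem_affineSemigroup_glueFamily {a : Fin p → (Fin n →₀ ℕ)} {b : Fin q → (Fin n →₀ ℕ)}
    {k₁ k₂ : ℕ} {t : Fin n →₀ ℕ} : t ∈ affineSemigroup (glueFamily a b k₁ k₂) ↔
      ∃ s ∈ affineSemigroup a, ∃ s' ∈ affineSemigroup b, t = k₁ • s + k₂ • s' := by
  constructor
  · rintro ⟨e, rfl⟩
    induction e using Finsupp.induction_linear with
    | zero => exact ⟨0, zero_mem _, 0, zero_mem _, by simp⟩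
    | add e e' h h' =>
      obtain ⟨s, hs, r, hr, h⟩ := h
      obtain ⟨s', hs', r', hr', h'⟩ := h'
      refine ⟨s + s', add_mem hs hs', r + r', add_mem hr hr', ?_⟩
      rw [map_add, h, h', smul_add, smul_add]
      abel
    | single i x =>
      rcases i with i | j
      · exact ⟨x • a i, ⟨Finsupp.single i x, by simp⟩, 0, zero_mem _,
          by simp [glueFamily, smul_comm x]⟩
      · exact ⟨0, zero_mem _, x • b j, ⟨Finsupp.single j x, by simp⟩,
          by simp [glueFamily, smul_comm x]⟩
  · rintro ⟨_, ⟨e, rfl⟩, _, ⟨e', rfl⟩, rfl⟩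
    refine ⟨e.mapDomain Sum.inl + e'.mapDomain Sum.inr, ?_⟩
    rw [map_add, Finsupp.linearCombination_mapDomain, Finsupp.linearCombination_mapDomain]
    simp only [Finsupp.linearCombination_apply, Finsupp.smul_sum, Function.comp_def, glueFamily,
      Sum.elim_inl, Sum.elim_inr, smul_comm _ k₁, smul_comm _ k₂]

theorem linearCombination_line {b : Fin q → (Fin n →₀ ℕ)} {d : Fin n →₀ ℕ} {u : Fin q → ℕ}
    (hb : ∀ j, b j = u j • d) (e : Fin q →₀ ℕ) :
    Finsupp.linearCombination ℕ b e = Finsupp.linearCombination ℕ u e • d := by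
  simp only [Finsupp.linearCombination_apply, Finsupp.sum, Finset.sum_smul, hb, smul_smul,
    smul_eq_mul]

theorem nsmul_left_injective_of_ne_zero {d : Fin n →₀ ℕ} (hd : d ≠ 0) :
    Function.Injective fun i : ℕ ↦ i • d := by
  obtain ⟨c, hc⟩ := Finsupp.ne_iff.mp hd
  intro i j h
  have h' := DFunLike.congr_fun h c
  simp only [Finsupp.smul_apply, smul_eq_mul] at h'
  exact Nat.eq_of_mul_eq_mul_right (Nat.pos_of_ne_zero hc) h'

theorem injective_aeval_monomial {d : Fin n →₀ ℕ} (hd : d ≠ 0) :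
    Function.Injective (Polynomial.aeval (R := k) (monomial d (1 : k))) := by
  classical
  rw [injective_iff_map_eq_zero]
  intro f hf
  ext i
  have h := congrArg (coeff (i • d)) hf
  rw [Polynomial.aeval_eq_sum_range, coeff_sum] at h
  simp only [monomial_pow, one_pow, coeff_smul, coeff_monomial, smul_eq_mul, mul_ite, mul_one,
    mul_zero, coeff_zero, (nsmul_left_injective_of_ne_zero hd).eq_iff] at h
  rw [Finset.sum_ite_eq'] at h
  rw [Polynomial.coeff_zero]
  by_contra hi
  have hmem := Finset.mem_range.mpr (Nat.lt_succ_of_le (Polynomial.le_natDegree_of_ne_zero hi))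
  exact hi (by rwa [if_pos hmem] at h)

theorem aeval_pow_monomial {A : Type*} [CommRing A] [Algebra k A] (x : A) (u : Fin q → ℕ)
    (e : Fin q →₀ ℕ) :
    aeval (fun j ↦ x ^ u j) (monomial e (1 : k)) = x ^ Finsupp.linearCombination ℕ u e := by
  rw [aeval_monomial, Finsupp.linearCombination_apply, Finsupp.prod, Finsupp.sum,
    ← Finset.prod_pow_eq_pow_sum]
  simp [← pow_mul, mul_comm]

/-- In a gluing along `ρ = x ^ α - y ^ β` with `B` on a line, the class modulo the degree of
`y ^ β` of the `B`-component of an element of `⟨C⟩` does not depend on the decomposition. -/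
theorem linearCombination_eq_of_gluing {a : Fin p → (Fin n →₀ ℕ)} {b : Fin q → (Fin n →₀ ℕ)}
    {d : Fin n →₀ ℕ} {u : Fin q → ℕ} (hb : ∀ j, b j = u j • d) (hd : d ≠ 0) {k₁ k₂ : ℕ}
    {α : Fin p →₀ ℕ} {β : Fin q →₀ ℕ}
    (hI : toricIdeal k (glueFamily a b k₁ k₂) ≤
      (toricIdeal k a).map (rename (Sum.inl : Fin p → Fin p ⊕ Fin q)) ⊔
      (toricIdeal k b).map (rename (Sum.inr : Fin q → Fin p ⊕ Fin q)) ⊔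
      Ideal.span {rename Sum.inl (monomial α (1 : k)) - rename Sum.inr (monomial β (1 : k))})
    {μ μ' : Fin p →₀ ℕ} {ν ν' : Fin q →₀ ℕ}
    (h : k₁ • Finsupp.linearCombination ℕ a μ + k₂ • Finsupp.linearCombination ℕ b ν =
      k₁ • Finsupp.linearCombination ℕ a μ' + k₂ • Finsupp.linearCombination ℕ b ν') :
    (Finsupp.linearCombination ℕ u ν : ZMod (Finsupp.linearCombination ℕ u β)) =
      (Finsupp.linearCombination ℕ u ν' : ZMod (Finsupp.linearCombination ℕ u β)) := by
  set m := Finsupp.linearCombination ℕ u β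
  -- The class mod `m` is read off in the group algebra of `ℤ/m` by `x_i ↦ 1`, `y_j ↦ ζ ^ u j`. This
  -- kills `I_A` because it factors through `t = 1`, and `ρ` because `ζ ^ m = 1`.
  let ζ : AddMonoidAlgebra k (ZMod m) := AddMonoidAlgebra.single 1 1
  have hζ (N : ℕ) : ζ ^ N = AddMonoidAlgebra.single (N : ZMod m) (1 : k) := by
    simp [ζ, AddMonoidAlgebra.single_pow]
  let θ : MvPolynomial (Fin p ⊕ Fin q) k →ₐ[k] AddMonoidAlgebra k (ZMod m) :=
    aeval (Sum.elim (fun _ ↦ 1) (fun j ↦ ζ ^ u j))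
  have hl (f : MvPolynomial (Fin p) k) : θ (rename Sum.inl f) = aeval (fun _ ↦ 1) f := by
    simp [θ, aeval_rename, Function.comp_def]
  have hr (f : MvPolynomial (Fin q) k) : θ (rename Sum.inr f) = aeval (fun j ↦ ζ ^ u j) f := by
    simp [θ, aeval_rename, Function.comp_def]
  have hlm (e : Fin p →₀ ℕ) : θ (rename Sum.inl (monomial e 1)) = 1 := by
    rw [hl, aeval_monomial, map_one, one_mul]
    exact Finset.prod_eq_one fun i _ ↦ one_pow _
  have hrm (e : Fin q →₀ ℕ) : θ (rename Sum.inr (monomial e 1)) =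
      AddMonoidAlgebra.single (Finsupp.linearCombination ℕ u e : ZMod m) (1 : k) := by
    rw [hr, aeval_pow_monomial, hζ]
  have hker : toricIdeal k (glueFamily a b k₁ k₂) ≤ RingHom.ker θ := by
    refine hI.trans (sup_le (sup_le ?_ ?_) ?_)
    · refine Ideal.map_le_iff_le_comap.mpr fun f hf ↦ ?_
      have hfac : (aeval (fun _ ↦ 1) : MvPolynomial (Fin p) k →ₐ[k] AddMonoidAlgebra k (ZMod m)) =
          (aeval (fun _ ↦ 1)).comp (toricMap k a) := by
        ext1 i
        rw [AlgHom.comp_apply, toricMap, aeval_X, aeval_X, aeval_monomial, map_one, one_mul]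
        exact (Finset.prod_eq_one fun i _ ↦ one_pow _).symm
      rw [Ideal.mem_comap, RingHom.mem_ker]
      have hf' : toricMap k a f = 0 := hf
      exact (hl f).trans (by rw [hfac, AlgHom.comp_apply, hf', map_zero])
    · refine Ideal.map_le_iff_le_comap.mpr fun f hf ↦ ?_
      -- As `d ≠ 0`, `X ↦ t ^ d` is injective, so `I_B` is the kernel of `y_j ↦ X ^ u j`, through
      -- which `θ` factors on the `y`-variables.
      have hfac : toricMap k b = (Polynomial.aeval (monomial d (1 : k))).comp
          (aeval (fun j ↦ (Polynomial.X : Polynomial k) ^ u j)) := by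
        ext1 j
        simp [toricMap, hb, monomial_pow]
      have hfac' : (aeval (fun j ↦ ζ ^ u j) : MvPolynomial (Fin q) k →ₐ[k] _) =
          (Polynomial.aeval ζ).comp (aeval (fun j ↦ (Polynomial.X : Polynomial k) ^ u j)) := by
        ext1 j
        simp
      have hf' : toricMap k b f = 0 := hf
      rw [hfac, AlgHom.comp_apply] at hf'
      have hf0 := (injective_iff_map_eq_zero _).mp (injective_aeval_monomial hd) _ hf'
      rw [Ideal.mem_comap, RingHom.mem_ker]
      exact (hr f).trans (by rw [hfac', AlgHom.comp_apply, hf0, map_zero])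
    · rw [Ideal.span_singleton_le_iff_mem, RingHom.mem_ker, map_sub, hlm, hrm,
        ZMod.natCast_self, AddMonoidAlgebra.one_def, sub_self]
  have hmem : rename Sum.inl (monomial μ (1 : k)) * rename Sum.inr (monomial ν (1 : k)) -
      rename Sum.inl (monomial μ' (1 : k)) * rename Sum.inr (monomial ν' (1 : k)) ∈
        toricIdeal k (glueFamily a b k₁ k₂) := by
    rw [toricIdeal, RingHom.mem_ker]
    simp only [map_sub, map_mul, toricMap_rename_inl, toricMap_rename_inr, toricMap_monomial,
      expand_monomial, monomial_mul, h, sub_self]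
  have h0 := hker hmem
  rw [RingHom.mem_ker, map_sub, map_mul, map_mul, hlm, hlm, hrm, hrm, one_mul, one_mul,
    sub_eq_zero] at h0
  exact (AddMonoidAlgebra.single_left_inj one_ne_zero).mp h0

theorem linearCombination_ne_zero {v : Fin p → (Fin n →₀ ℕ)} (hv : ∀ i, v i ≠ 0)
    {e : Fin p →₀ ℕ} (he : e ≠ 0) : Finsupp.linearCombination ℕ v e ≠ 0 := by
  intro h
  refine he (Finsupp.ext fun i ↦ ?_)
  by_contra hi
  rw [Finsupp.linearCombination_apply, Finsupp.sum, Finset.sum_eq_zero_iff] at h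
  exact (smul_eq_zero.mp (h i (Finsupp.mem_support_iff.mpr hi))).elim hi (hv i)

theorem faithfullyFlat_of_basis {R S W : Type*} [CommRing R] [CommRing S] [Nontrivial S]
    [Algebra R S] (B : Module.Basis W R S) : Module.FaithfullyFlat R S :=
  have := Module.Free.of_basis B
  inferInstance

/-- The inclusion `k[A] → k[C]`, `t ^ s ↦ t ^ (k₁ s)`. -/
def glueMap (a : Fin p → (Fin n →₀ ℕ)) (b : Fin q → (Fin n →₀ ℕ)) (k₁ k₂ : ℕ) :
    semigroupRing k a →ₐ[k] semigroupRing k (glueFamily a b k₁ k₂) :=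
  ((expand k₁).comp (semigroupRing k a).val).codRestrict _ (by
    rintro ⟨_, f, rfl⟩
    exact ⟨rename Sum.inl f, toricMap_rename_inl a b k₁ k₂ f⟩)

end Gluing

end SemigroupGluing

end

/-! ### The main theorem -/

open SemigroupGluing in
theorem corollary4p5 (k : Type*) [Field k] {n p q : ℕ}
    (a : Fin p → (Fin n →₀ ℕ)) (b : Fin q → (Fin n →₀ ℕ))
    (h0 : (∀ i, a i ≠ 0) ∨ (∀ j, b j ≠ 0))
    (hline : SemigroupGluing.LieOnLine b)
    (k₁ k₂ : ℕ) (hglue : SemigroupGluing.IsGluing k a b k₁ k₂) :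
    ringKrullDim (SemigroupGluing.semigroupRing k (SemigroupGluing.glueFamily a b k₁ k₂)) =
        ringKrullDim (SemigroupGluing.semigroupRing k a) ∧
      SemigroupGluing.depth k (SemigroupGluing.glueFamily a b k₁ k₂) =
        SemigroupGluing.depth k a ∧
      (SemigroupGluing.IsCohenMacaulay
          (SemigroupGluing.semigroupRing k (SemigroupGluing.glueFamily a b k₁ k₂)) ↔
        SemigroupGluing.IsCohenMacaulay (SemigroupGluing.semigroupRing k a)) := by
  obtain ⟨-, d, u, hb⟩ := hline
  obtain ⟨hk₁, hk₂, α, β, hα, hβ, hI⟩ := hglue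
  have hdeg : k₁ • Finsupp.linearCombination ℕ a α = k₂ • Finsupp.linearCombination ℕ b β := by
    have hρ : MvPolynomial.rename Sum.inl (MvPolynomial.monomial α (1 : k)) -
        MvPolynomial.rename Sum.inr (MvPolynomial.monomial β (1 : k)) ∈
          toricIdeal k (glueFamily a b k₁ k₂) := by
      rw [hI]
      exact Ideal.mem_sup_right (Ideal.mem_span_singleton_self _)
    rw [toricIdeal, RingHom.mem_ker, map_sub, toricMap_rename_inl, toricMap_rename_inr,
      toricMap_monomial, toricMap_monomial, MvPolynomial.expand_monomial,
      MvPolynomial.expand_monomial, sub_eq_zero] at hρ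
    exact MvPolynomial.monomial_left_injective one_ne_zero hρ
  -- Whichever family avoids zero, the two sides of `hdeg` are nonzero together; this yields both `m
  -- > 0` and `d ≠ 0`.
  have hβ0 : Finsupp.linearCombination ℕ b β ≠ 0 := by
    rcases h0 with h0 | h0
    · intro h
      rw [h, smul_zero, smul_eq_zero] at hdeg
      exact linearCombination_ne_zero h0 hα (hdeg.resolve_left hk₁.ne')
    · exact linearCombination_ne_zero h0 hβ
  rw [linearCombination_line hb] at hβ0 hdeg
  set m := Finsupp.linearCombination ℕ u β with hm_def
  obtain ⟨hm0, hd⟩ := smul_ne_zero_iff.mp hβ0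
  have hm : 0 < m := Nat.pos_of_ne_zero hm0
  let S : Submodule ℕ ℕ := LinearMap.range (Finsupp.linearCombination ℕ u)
  have hmS : m ∈ S := ⟨β, rfl⟩
  have hαA : Finsupp.linearCombination ℕ a α ∈ affineSemigroup a := ⟨α, rfl⟩
  have hmemB (w : ℕ) (hw : w ∈ S) : w • d ∈ affineSemigroup b := by
    obtain ⟨e, rfl⟩ := hw
    exact ⟨e, linearCombination_line hb e⟩
  have hmemC {t : Fin n →₀ ℕ} : t ∈ affineSemigroup (glueFamily a b k₁ k₂) ↔
      ∃ s ∈ affineSemigroup a, ∃ w ∈ S, t = k₁ • s + k₂ • w • d := by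
    rw [mem_affineSemigroup_glueFamily]
    refine exists_congr fun s ↦ and_congr_right fun _ ↦ ⟨?_, ?_⟩
    · rintro ⟨_, ⟨e, rfl⟩, rfl⟩
      exact ⟨_, ⟨e, rfl⟩, by rw [linearCombination_line hb]⟩
    · rintro ⟨w, hw, rfl⟩
      exact ⟨_, hmemB w hw, rfl⟩
  let := (glueMap (k := k) a b k₁ k₂).toRingHom.toAlgebra
  have halg (f : semigroupRing k a) :
      (algebraMap (semigroupRing k a) (semigroupRing k (glueFamily a b k₁ k₂)) f :
        MvPolynomial (Fin n) k) = MvPolynomial.expand k₁ (f : MvPolynomial (Fin n) k) := rfl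
  obtain ⟨B⟩ := nonempty_basis_of_existsUnique hk₁ halg
    (fun w : aperySet S m ↦ k₂ • (w : ℕ) • d)
    (fun w ↦ hmemC.mpr ⟨0, zero_mem _, w, w.2.1, by simp⟩)
    (fun t ht ↦ by
      obtain ⟨s, hs, v, hv, rfl⟩ := hmemC.mp ht
      obtain ⟨w, hw, j, rfl⟩ := exists_mem_aperySet hm hv
      -- The excess `k₂ (j m) d` is absorbed into the `A`-part by `hdeg`.
      refine ⟨s + j • Finsupp.linearCombination ℕ a α,
        add_mem hs (Submodule.smul_mem _ _ hαA), ⟨w, hw⟩, ?_⟩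
      rw [smul_add, smul_comm k₁ j, hdeg, add_smul, mul_smul, smul_add, smul_comm k₂ j]
      abel)
    (fun _ ⟨μ, hμ⟩ _ ⟨μ', hμ'⟩ ⟨w, hw⟩ ⟨w', hw'⟩ h ↦ by
      obtain ⟨ν, hν⟩ := hw.1
      obtain ⟨ν', hν'⟩ := hw'.1
      refine Subtype.ext (aperySet_injOn hmS hw hw' ?_)
      simp only [← hμ, ← hμ', ← hν, ← hν', ← linearCombination_line hb] at h
      simpa only [hν, hν'] using linearCombination_eq_of_gluing hb hd hI.le h)
  have : Finite (aperySet S m) := finite_aperySet hm hmS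
  have := Module.Finite.of_basis B
  have := faithfullyFlat_of_basis B
  refine ⟨ringKrullDim_eq_of_isIntegral_of_faithfullyFlat,
    idealDepth_eq_of_faithfullyFlat (map_irrelevantIdeal_le hk₁ halg)
      (irrelevantIdeal_le_radical_map halg hm fun t ht ↦ ?_) (RingHom.ker_ne_top _),
    isCohenMacaulay_iff_of_isIntegral_of_faithfullyFlat⟩
  obtain ⟨s, hs, w, -, rfl⟩ := hmemC.mp ht
  -- Multiplying by `m` turns `k₂ w d` into `w` copies of `k₂ m d`, each of which lies in `k₁⟨A⟩` by
  -- `hdeg`.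
  refine ⟨m • s + w • Finsupp.linearCombination ℕ a α,
    add_mem (Submodule.smul_mem _ _ hs) (Submodule.smul_mem _ _ hαA), ?_⟩
  rw [smul_add, smul_add, smul_comm k₁ w, hdeg, smul_comm k₁ m, smul_comm m k₂, smul_comm m w,
    smul_comm w k₂]
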